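/- Let $\mathfrak{n}$ be a finite-dimensional complex simple Lie algebra of type $C_n$ with a Cartan subalgebra $\mathfrak{h}$ and simple roots $\Delta^0=\{\alpha_1,\dots,\alpha_n\}$, numbered so that the Cartan matrix has its standard form, with $\alpha_n$ the long simple root. Let $1\le i<n$ and $\Sigma_i=\{\alpha_i,\alpha_n\}$. The height of a root $\alpha=\sum_j a_j\alpha_j$ with respect to $\Sigma_i$ is $ht_{\Sigma_i}(\alpha)=a_i+a_n$. Consider the associated $|3|$-grading $\mathfrak{n}=\mathfrak{n}_{-3}\oplus\cdots\oplus\mathfrak{n}_{3}$, in which $\mathfrak{n}_k$ is the sum of the root spaces of the roots $\alpha$ with $ht_{\Sigma_i}(\alpha)=k$, together with $\mathfrak{h}$ if $k=0$. Its negative part is the graded Lie subalgebra $\mathfrak{n}_-=\bigoplus_{k<0}\mathfrak{n}_k=\mathfrak{n}_{-3}\oplus\mathfrak{n}_{-2}\oplus\mathfrak{n}_{-1}$. For $r\ge 0$ let $\mathfrak{F}_{r,3}=\mathfrak{f}_{-3}\oplus\mathfrak{f}_{-2}\oplus\mathfrak{f}_{-1}$ be the complex free nilpotent Lie algebra of step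 $3$ on $r$ generators, that is, the free Lie algebra on $r$ generators modulo the ideal spanned by all brackets of at least four elements, with its canonical grading: $\mathfrak{f}_{-m}$ is spanned by the brackets of $m$ generators. Then, for every $r$, there is no graded isomorphism between $\mathfrak{F}_{r,3}$ and $\mathfrak{n}_{-3}\oplus\mathfrak{n}_{-2}\oplus\mathfrak{n}_{-1}$, that is, no isomorphism of Lie algebras which maps $\mathfrak{f}_{k}$ onto $\mathfrak{n}_{k}$ for every $k\in\{-3,-2,-1\}$. -/

import Mathlib

open LieAlgebra LieModule

noncomputable section

namespace GradedLie

/-- Two families `𝔤`, `𝔪` of subspaces indexed by `ℤ` are the homogeneous components of two graded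
Lie algebras.  A Lie algebra isomorphism is graded if it restricts, in every degree, to an
isomorphism between the homogeneous components. -/
def IsGradedIso {L M : Type*} [LieRing L] [LieAlgebra ℂ L] [LieRing M] [LieAlgebra ℂ M]
    (𝔤 : ℤ → Submodule ℂ L) (𝔪 : ℤ → Submodule ℂ M) (φ : L ≃ₗ⁅ℂ⁆ M) : Prop :=
  ∀ k : ℤ, (𝔤 k).map (φ.toLinearEquiv : L →ₗ[ℂ] M) = 𝔪 k

section Height

variable {L : Type*} [LieRing L] [LieAlgebra ℂ L] [FiniteDimensional ℂ L] [IsKilling ℂ L]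
  {H : LieSubalgebra ℂ L} [H.IsCartanSubalgebra]

/-- The height of `lam = ∑ a_β β` with respect to a set `S` of simple roots, namely the sum of the
coefficients `a_β` over `β ∈ S`. It is a linear function of `lam`. -/
def ht (b : (IsKilling.rootSystem H).Base) (S : Finset b.support) (lam : Module.Dual ℂ H) : ℂ :=
  ∑ β ∈ S, b.toWeightBasis.repr lam β

/-- The degree `k` component of the grading of `L` associated to the set `S` of simple roots: the
sum of the root spaces of height `k`. The linear form `lam` runs through the whole dual of `H`;
if it is neither zero nor a root, then its root space is zero, and the root space of `0` is `H`,
which lies in degree `0`. -/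
def component (b : (IsKilling.rootSystem H).Base) (S : Finset b.support) (k : ℤ) :
    Submodule ℂ L :=
  ⨆ (lam : Module.Dual ℂ H) (_ : ht b S lam = (k : ℂ)), (rootSpace H lam).toSubmodule

theorem ht_add (b : (IsKilling.rootSystem H).Base) (S : Finset b.support)
    (lam mu : Module.Dual ℂ H) : ht b S (lam + mu) = ht b S lam + ht b S mu := by
  simp [ht, Finset.sum_add_distrib]

theorem lie_mem_component (b : (IsKilling.rootSystem H).Base) (S : Finset b.support) {j k : ℤ}
    {x y : L} (hx : x ∈ component b S j) (hy : y ∈ component b S k) :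
    ⁅x, y⁆ ∈ component b S (j + k) := by
  induction hx using Submodule.iSup_induction' with
  | zero => simp
  | add x x' _ _ hx hx' => rw [add_lie]; exact add_mem hx hx'
  | mem lam x hx =>
    induction hx using Submodule.iSup_induction' with
    | zero => simp
    | add x x' _ _ hx hx' => rw [add_lie]; exact add_mem hx hx'
    | mem hl x hx =>
      induction hy using Submodule.iSup_induction' with
      | zero => simp
      | add y y' _ _ hy hy' => rw [lie_add]; exact add_mem hy hy'
      | mem mu y hy =>
        induction hy using Submodule.iSup_induction' with
        | zero => simp
        | add y y' _ _ hy hy' => rw [lie_add]; exact add_mem hy hy'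
        | mem hm y hy =>
          refine Submodule.mem_iSup_of_mem (lam + mu) (Submodule.mem_iSup_of_mem ?_ ?_)
          · rw [ht_add, hl, hm]; push_cast; rfl
          · exact lie_mem_genWeightSpace_of_mem_genWeightSpace hx hy

/-- The negative part of the grading of `L` associated to `S`: the sum of the components of
negative degree, with the Lie bracket of `L`. -/
def negativePart (b : (IsKilling.rootSystem H).Base) (S : Finset b.support) :
    LieSubalgebra ℂ L where
  toSubmodule := ⨆ (k : ℤ) (_ : k < 0), component b S k
  lie_mem' := by
    intro x y hx hy
    change ⁅x, y⁆ ∈ ⨆ (k : ℤ) (_ : k < 0), component b S k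
    change x ∈ ⨆ (k : ℤ) (_ : k < 0), component b S k at hx
    change y ∈ ⨆ (k : ℤ) (_ : k < 0), component b S k at hy
    induction hx using Submodule.iSup_induction' with
    | zero => simp
    | add x x' _ _ hx hx' => rw [add_lie]; exact add_mem hx hx'
    | mem j x hx =>
      induction hx using Submodule.iSup_induction' with
      | zero => simp
      | add x x' _ _ hx hx' => rw [add_lie]; exact add_mem hx hx'
      | mem hj x hx =>
        induction hy using Submodule.iSup_induction' with
        | zero => simp
        | add y y' _ _ hy hy' => rw [lie_add]; exact add_mem hy hy'
        | mem k y hy =>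
          induction hy using Submodule.iSup_induction' with
          | zero => simp
          | add y y' _ _ hy hy' => rw [lie_add]; exact add_mem hy hy'
          | mem hk y hy =>
            exact Submodule.mem_iSup_of_mem (j + k) (Submodule.mem_iSup_of_mem (by omega)
              (lie_mem_component b S hx hy))

/-- The homogeneous components of the negative part, as subspaces of it. -/
def negativeComponent (b : (IsKilling.rootSystem H).Base) (S : Finset b.support) (k : ℤ) :
    Submodule ℂ (negativePart b S) :=
  if k < 0 then (component b S k).comap (negativePart b S).toSubmodule.subtype else ⊥

/-- The base `b`, with its simple roots numbered `α₁, …, αₙ` by `e` (so that `αₚ₊₁` is `e p`), is of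
type `Cₙ`: the numbers `⟨αₚ, α_q^∨⟩` form the Cartan matrix of type `Cₙ`, in which `αₙ` is the long
simple root. -/
def IsTypeC {n : ℕ} (b : (IsKilling.rootSystem H).Base) (e : Fin n ≃ b.support) : Prop :=
  ∀ p q : Fin n, b.cartanMatrix (e p) (e q) = CartanMatrix.C n p q

end Height

section FreeNilpotent

/-- `IsLieMonomial r m w`: the element `w` of the free Lie algebra on `r` generators is an iterated
bracket, in any arrangement, of `m` generators. -/
inductive IsLieMonomial (r : ℕ) : ℕ → FreeLieAlgebra ℂ (Fin r) → Prop
  | of (a : Fin r) : IsLieMonomial r 1 (FreeLieAlgebra.of ℂ a)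
  | lie {l m : ℕ} {v w : FreeLieAlgebra ℂ (Fin r)} :
      IsLieMonomial r l v → IsLieMonomial r m w → IsLieMonomial r (l + m) ⁅v, w⁆

/-- The free nilpotent Lie algebra of step `k` on `r` generators: the free Lie algebra modulo the
ideal spanned by all brackets of at least `k + 1` elements (the first term of the lower central
series, the whole algebra, has index `0`). -/
abbrev FreeNilpotent (r k : ℕ) : Type :=
  FreeLieAlgebra ℂ (Fin r) ⧸
    lowerCentralSeries ℂ (FreeLieAlgebra ℂ (Fin r)) (FreeLieAlgebra ℂ (Fin r)) k

/-- The canonical grading of the free nilpotent Lie algebra: the component of degree `-m` is spanned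
by the classes of the brackets of `m` generators. -/
def freeComponent (r k : ℕ) (d : ℤ) : Submodule ℂ (FreeNilpotent r k) :=
  Submodule.span ℂ {x | ∃ (m : ℕ) (w : FreeLieAlgebra ℂ (Fin r)), d = -(m : ℤ) ∧
    IsLieMonomial r m w ∧ x = LieSubmodule.Quotient.mk w}

end FreeNilpotent

end GradedLie

end

/-!
The obstruction is a single relation in degree `-3`. Let `β = αᵢ` and `γ = αₙ` be the two simple
roots in `Σᵢ`. Root vectors `x`, `y` of `-β`, `-γ` lie in degree `-1` and are linearly independent.
Since `γ` is long, `⟨β, γ^∨⟩` is `-1` or `0`, so `β + 2γ` is not a root and `⁅y, ⁅y, x⁆⁆ = 0`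
(`lie_lie_eq_zero_of_neg_one_le_cartanMatrix`).

In the free nilpotent Lie algebra of step `3` no such relation can hold between linearly independent
elements of degree `-1` (`lie_lie_ne_zero_of_mem_freeComponent_neg_one`): generators may be sent
anywhere in a Lie algebra that is nilpotent of step `3`, and the strictly upper triangular
`4 × 4` matrices contain `X`, `Y` with `⁅X, ⁅X, Y⁆⁆ ≠ 0`. A graded isomorphism preserves degree
`-1`, linear independence and brackets, so it cannot exist.
-/

namespace GradedLie

/-! ### Free nilpotent Lie algebras and strictly upper triangular matrices -/

section FreeNilpotent

attribute [local instance] LieRing.ofAssociativeRing LieAlgebra.ofAssociativeAlgebra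

/-- The complex `n × n` matrices supported on and above the `d`-th superdiagonal. -/
def upperMatrix (n : ℕ) (d : ℕ) : Submodule ℂ (Matrix (Fin n) (Fin n) ℂ) where
  carrier := {A | ∀ i j : Fin n, (j : ℕ) < i + d → A i j = 0}
  zero_mem' := by intro i j _; rfl
  add_mem' := by
    intro A B hA hB i j h
    rw [Matrix.add_apply, hA i j h, hB i j h, add_zero]
  smul_mem' := by
    intro c A hA i j h
    rw [Matrix.smul_apply, hA i j h, smul_zero]

theorem mul_mem_upperMatrix {n c d : ℕ} {A B : Matrix (Fin n) (Fin n) ℂ}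
    (hA : A ∈ upperMatrix n c) (hB : B ∈ upperMatrix n d) : A * B ∈ upperMatrix n (c + d) := by
  intro i j h
  rw [Matrix.mul_apply]
  refine Finset.sum_eq_zero fun l _ => ?_
  by_cases hl : (l : ℕ) < i + c
  · rw [hA i l hl, zero_mul]
  · rw [hB l j (by omega), mul_zero]

theorem lie_mem_upperMatrix {n c d : ℕ} {A B : Matrix (Fin n) (Fin n) ℂ}
    (hA : A ∈ upperMatrix n c) (hB : B ∈ upperMatrix n d) : ⁅A, B⁆ ∈ upperMatrix n (c + d) := by
  rw [Ring.lie_def]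
  exact sub_mem (mul_mem_upperMatrix hA hB) (add_comm c d ▸ mul_mem_upperMatrix hB hA)

/-- The Lie algebra of strictly upper triangular matrices. -/
def strictlyUpperMatrix (n : ℕ) : LieSubalgebra ℂ (Matrix (Fin n) (Fin n) ℂ) where
  toSubmodule := upperMatrix n 1
  lie_mem' := by
    intro A B hA hB i j h
    exact lie_mem_upperMatrix hA hB i j (by omega)

/-- By uniqueness, `F` is the lift of its values on generators to the Lie subalgebra of strictly
upper triangular matrices. -/
theorem mem_strictlyUpperMatrix_of_forall_of {n r : ℕ}
    {F : FreeLieAlgebra ℂ (Fin r) →ₗ⁅ℂ⁆ Matrix (Fin n) (Fin n) ℂ}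
    (hF : ∀ a, F (FreeLieAlgebra.of ℂ a) ∈ strictlyUpperMatrix n)
    (w : FreeLieAlgebra ℂ (Fin r)) : F w ∈ strictlyUpperMatrix n := by
  let G : FreeLieAlgebra ℂ (Fin r) →ₗ⁅ℂ⁆ strictlyUpperMatrix n :=
    FreeLieAlgebra.lift ℂ fun a => ⟨F (FreeLieAlgebra.of ℂ a), hF a⟩
  have h : (strictlyUpperMatrix n).incl.comp G = F := by
    ext1 a
    simp [G]
  rw [← h]
  exact (G w).2

/-- In particular `F` kills the term of index `3` of the lower central series if `n = 4`, hence
factors through the free nilpotent Lie algebra of step `3`. -/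
theorem map_mem_upperMatrix_of_mem_lowerCentralSeries {n r : ℕ}
    {F : FreeLieAlgebra ℂ (Fin r) →ₗ⁅ℂ⁆ Matrix (Fin n) (Fin n) ℂ}
    (hF : ∀ a, F (FreeLieAlgebra.of ℂ a) ∈ strictlyUpperMatrix n) (k : ℕ)
    {w : FreeLieAlgebra ℂ (Fin r)}
    (hw : w ∈ lowerCentralSeries ℂ (FreeLieAlgebra ℂ (Fin r)) (FreeLieAlgebra ℂ (Fin r)) k) :
    F w ∈ upperMatrix n (k + 1) := by
  induction k generalizing w with
  | zero => exact mem_strictlyUpperMatrix_of_forall_of hF w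
  | succ k ih =>
    rw [LieModule.lowerCentralSeries_succ, ← LieSubmodule.mem_toSubmodule,
      LieSubmodule.lieIdeal_oper_eq_linear_span'] at hw
    induction hw using Submodule.span_induction with
    | mem w hw =>
      obtain ⟨u, -, v, hv, rfl⟩ := hw
      rw [LieHom.map_lie, add_comm]
      exact lie_mem_upperMatrix (mem_strictlyUpperMatrix_of_forall_of hF u) (ih hv)
    | zero => rw [map_zero]; exact zero_mem _
    | add u v _ _ hu hv => rw [map_add]; exact add_mem hu hv
    | smul c u _ hu => rw [map_smul]; exact Submodule.smul_mem _ c hu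

theorem IsLieMonomial.one_le {r m : ℕ} {w : FreeLieAlgebra ℂ (Fin r)}
    (h : IsLieMonomial r m w) : 1 ≤ m := by
  induction h with
  | of a => exact le_rfl
  | lie _ _ _ _ => omega

theorem IsLieMonomial.eq_of_of_eq_one {r m : ℕ} {w : FreeLieAlgebra ℂ (Fin r)}
    (h : IsLieMonomial r m w) (hm : m = 1) : ∃ a, w = FreeLieAlgebra.of ℂ a := by
  cases h with
  | of a => exact ⟨a, rfl⟩
  | lie hv hw =>
    have := hv.one_le
    have := hw.one_le
    omega

theorem exists_coeff_of_mem_freeComponent_neg_one {r k : ℕ} {x : FreeNilpotent r k}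
    (hx : x ∈ freeComponent r k (-1)) :
    ∃ c : Fin r → ℂ,
      x = LieSubmodule.Quotient.mk (∑ a, c a • FreeLieAlgebra.of ℂ a) := by
  induction hx using Submodule.span_induction with
  | mem x hx =>
    obtain ⟨m, w, hm, hw, rfl⟩ := hx
    obtain ⟨a, rfl⟩ := hw.eq_of_of_eq_one (by omega)
    exact ⟨Pi.single a 1, by simp [Pi.single_apply]⟩
  | zero => exact ⟨0, by simp⟩
  | add x y _ _ hx hy =>
    obtain ⟨c, rfl⟩ := hx
    obtain ⟨d, rfl⟩ := hy
    exact ⟨c + d, by simp [add_smul, Finset.sum_add_distrib]⟩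
  | smul t x _ hx =>
    obtain ⟨c, rfl⟩ := hx
    refine ⟨t • c, ?_⟩
    rw [← LieSubmodule.Quotient.mk'_apply, ← LieSubmodule.Quotient.mk'_apply, ← map_smul,
      Finset.smul_sum]
    simp [mul_smul]

/-- No two linearly independent elements `x`, `y` of degree `-1` in the free nilpotent Lie algebra
of step `3` satisfy the Serre-type relation `⁅y, ⁅y, x⁆⁆ = 0`: some homomorphism to the strictly
upper triangular `4 × 4` matrices sends `y` to `E₀₁ + E₁₂` and `x` to `E₂₃`, and
`⁅E₀₁ + E₁₂, ⁅E₀₁ + E₁₂, E₂₃⁆⁆ = E₀₃`. -/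
theorem lie_lie_ne_zero_of_mem_freeComponent_neg_one {r : ℕ} {x y : FreeNilpotent r 3}
    (hx : x ∈ freeComponent r 3 (-1)) (hy : y ∈ freeComponent r 3 (-1))
    (hxy : LinearIndependent ℂ ![x, y]) : ⁅y, ⁅y, x⁆⁆ ≠ 0 := by
  obtain ⟨c, rfl⟩ := exists_coeff_of_mem_freeComponent_neg_one hx
  obtain ⟨d, rfl⟩ := exists_coeff_of_mem_freeComponent_neg_one hy
  let T : (Fin r → ℂ) →ₗ[ℂ] FreeLieAlgebra ℂ (Fin r) :=
    Fintype.linearCombination ℂ (FreeLieAlgebra.of ℂ)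
  have hcd : LinearIndependent ℂ ![c, d] := by
    refine LinearIndependent.of_comp ((LieSubmodule.Quotient.mk' (lowerCentralSeries ℂ
      (FreeLieAlgebra ℂ (Fin r)) (FreeLieAlgebra ℂ (Fin r)) 3)).toLinearMap ∘ₗ T) ?_
    convert hxy using 1
    ext j
    fin_cases j <;> rfl
  -- `p` sends `c` and `d` to the standard basis of `ℂ²`, so that `F` below is prescribed on `x`, `y`.
  obtain ⟨p, hp⟩ := LinearMap.exists_leftInverse_of_injective
    (Fintype.linearCombination ℂ ![c, d])
    (LinearMap.ker_eq_bot.mpr hcd.fintypeLinearCombination_injective)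
  let X : Matrix (Fin 4) (Fin 4) ℂ := !![0, 1, 0, 0; 0, 0, 1, 0; 0, 0, 0, 0; 0, 0, 0, 0]
  let Y : Matrix (Fin 4) (Fin 4) ℂ := !![0, 0, 0, 0; 0, 0, 0, 0; 0, 0, 0, 1; 0, 0, 0, 0]
  have hX : X ∈ upperMatrix 4 1 := by
    intro i j h
    fin_cases i <;> fin_cases j <;> simp [X] at h ⊢
  have hY : Y ∈ upperMatrix 4 1 := by
    intro i j h
    fin_cases i <;> fin_cases j <;> simp [Y] at h ⊢
  let M : (Fin r → ℂ) →ₗ[ℂ] Matrix (Fin 4) (Fin 4) ℂ := Fintype.linearCombination ℂ ![Y, X] ∘ₗ p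
  have hM (v : Fin r → ℂ) : M v = p v 0 • Y + p v 1 • X := by
    simp [M, Fintype.linearCombination_apply]
  let F : FreeLieAlgebra ℂ (Fin r) →ₗ⁅ℂ⁆ Matrix (Fin 4) (Fin 4) ℂ :=
    FreeLieAlgebra.lift ℂ fun a => M (Pi.single a 1)
  have hF (a : Fin r) : F (FreeLieAlgebra.of ℂ a) ∈ strictlyUpperMatrix 4 := by
    change F (FreeLieAlgebra.of ℂ a) ∈ upperMatrix 4 1
    simp only [F, FreeLieAlgebra.lift_of_apply, hM]
    exact add_mem (Submodule.smul_mem _ _ hY) (Submodule.smul_mem _ _ hX)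
  have hFT (v : Fin r → ℂ) : F (∑ a, v a • FreeLieAlgebra.of ℂ a) = M v := by
    conv_rhs => rw [pi_eq_sum_univ' v]
    simp only [F, map_sum, map_smul, FreeLieAlgebra.lift_of_apply]
  have hpc : p c = Pi.single 0 1 := by
    simpa [Fintype.linearCombination_apply_single] using
      LinearMap.congr_fun hp (Pi.single (0 : Fin 2) 1)
  have hpd : p d = Pi.single 1 1 := by
    simpa [Fintype.linearCombination_apply_single] using
      LinearMap.congr_fun hp (Pi.single (1 : Fin 2) 1)
  have hFc : F (∑ a, c a • FreeLieAlgebra.of ℂ a) = Y := by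
    simp [hFT, hM, hpc]
  have hFd : F (∑ a, d a • FreeLieAlgebra.of ℂ a) = X := by
    simp [hFT, hM, hpd]
  intro h0
  rw [← LieSubmodule.Quotient.mk_bracket, ← LieSubmodule.Quotient.mk_bracket,
    LieSubmodule.Quotient.mk_eq_zero'] at h0
  -- A matrix supported on and above the fourth superdiagonal is zero; the corner entry shows it.
  have h03 := map_mem_upperMatrix_of_mem_lowerCentralSeries hF 3 h0 0 3 (by simp)
  rw [LieHom.map_lie, LieHom.map_lie, hFc, hFd] at h03
  simp [X, Y, Ring.lie_def] at h03

end FreeNilpotent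

/-! ### Root vectors of two simple roots -/

section Height

variable {L : Type*} [LieRing L] [LieAlgebra ℂ L] [FiniteDimensional ℂ L] [IsKilling ℂ L]
  {H : LieSubalgebra ℂ L} [H.IsCartanSubalgebra]

theorem exists_ne_zero_mem_rootSpace_neg_root (α : H.root) :
    ∃ x ∈ rootSpace H (-((IsKilling.rootSystem H).root α) : Module.Dual ℂ H), x ≠ 0 := by
  obtain ⟨x, hx, hx0⟩ := (-(α : Weight ℂ H L)).exists_ne_zero
  exact ⟨x, by simpa using hx, hx0⟩

theorem mem_component_of_mem_rootSpace_neg_root (b : (IsKilling.rootSystem H).Base)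
    {S : Finset b.support} {β : b.support} (hβ : β ∈ S) {x : L}
    (hx : x ∈ rootSpace H (-((IsKilling.rootSystem H).root β) : Module.Dual ℂ H)) :
    x ∈ component b S (-1) := by
  refine Submodule.mem_iSup_of_mem (-((IsKilling.rootSystem H).root β))
    (Submodule.mem_iSup_of_mem ?_ hx)
  simp only [ht, map_neg, RootPairing.Base.toWeightBasis_repr_root]
  classical simp [Finsupp.single_apply, hβ]

/-- The relation `⁅y, ⁅y, x⁆⁆ = 0` for root vectors `x`, `y` of `-β`, `-γ`, where `β`, `γ` are simple
roots: it holds as soon as `⟨β, γ^∨⟩ ≥ -1`, because then `β + 2γ` is not a root. -/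
theorem lie_lie_eq_zero_of_neg_one_le_cartanMatrix (b : (IsKilling.rootSystem H).Base)
    {β γ : b.support} (hne : β ≠ γ) (hc : -1 ≤ b.cartanMatrix β γ) {x y : L}
    (hx : x ∈ rootSpace H (-((IsKilling.rootSystem H).root β) : Module.Dual ℂ H))
    (hy : y ∈ rootSpace H (-((IsKilling.rootSystem H).root γ) : Module.Dual ℂ H)) :
    ⁅y, ⁅y, x⁆⁆ = 0 := by
  let P := IsKilling.rootSystem H
  have hlin : LinearIndependent ℂ ![P.root γ, P.root β] :=
    b.linearIndependent_pair_of_ne (i := γ) (j := β) hne.symm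
  have hmem : ⁅y, ⁅y, x⁆⁆ ∈ rootSpace H (-(P.root β + 2 • P.root γ) : Module.Dual ℂ H) := by
    have := lie_mem_genWeightSpace_of_mem_genWeightSpace hy
      (lie_mem_genWeightSpace_of_mem_genWeightSpace hy hx)
    convert this using 2
    ext t
    simp [P]
    ring
  by_contra h0
  have hnot : P.root β + 2 • P.root γ ∉ Set.range P.root := by
    rw [RootPairing.root_add_nsmul_mem_range_iff_le_chainTopCoeff hlin]
    have := b.cartanMatrix_eq_neg_chainTopCoeff hne
    omega
  let χ : Weight ℂ H L := 
    ⟨(-(P.root β + 2 • P.root γ) : Module.Dual ℂ H), fun h =>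
      h0 ((LieSubmodule.mem_bot _).mp (h.le hmem))⟩
  have hχ : χ.IsNonZero := by
    intro hz
    have h2 : P.root β + (2 : ℂ) • P.root γ = 0 := by
      ext t
      have h : -(P.root β t + 2 • P.root γ t) = 0 := congrFun hz t
      simpa using neg_eq_zero.mp h
    have := (LinearIndependent.pair_iff.mp hlin 2 1 (by simpa [add_comm] using h2)).2
    exact one_ne_zero this
  refine hnot ((P.neg_mem_range_root_iff).mp ⟨⟨χ, by simpa using hχ⟩, ?_⟩)
  ext t
  simp [P, χ]

omit [FiniteDimensional ℂ L] [IsKilling ℂ L] in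
theorem linearIndependent_of_mem_rootSpace {lam mu : Module.Dual ℂ H} (hne : lam ≠ mu) {x y : L}
    (hx : x ∈ rootSpace H lam) (hy : y ∈ rootSpace H mu) (hx0 : x ≠ 0) (hy0 : y ≠ 0) :
    LinearIndependent ℂ ![x, y] := by
  have hind := (LieSubmodule.iSupIndep_toSubmodule.mpr (iSupIndep_genWeightSpace ℂ H L)).comp
    (f := ![(lam : H → ℂ), (mu : H → ℂ)]) (by
      intro p q h
      fin_cases p <;> fin_cases q <;> simp_all [DFunLike.coe_fn_eq, eq_comm])
  refine hind.linearIndependent _ ?_ ?_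
  · intro p
    fin_cases p
    exacts [hx, hy]
  · intro p
    fin_cases p
    exacts [hx0, hy0]

/-- If `S` contains two simple roots `β ≠ γ` with `⟨β, γ^∨⟩ ≥ -1`, then `𝔫₋` is not free nilpotent of
step `3` as a graded Lie algebra, in any type. -/
theorem not_isGradedIso_of_neg_one_le_cartanMatrix (b : (IsKilling.rootSystem H).Base)
    {S : Finset b.support} {β γ : b.support} (hβ : β ∈ S) (hγ : γ ∈ S) (hne : β ≠ γ)
    (hc : -1 ≤ b.cartanMatrix β γ) {r : ℕ} (φ : FreeNilpotent r 3 ≃ₗ⁅ℂ⁆ negativePart b S) :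
    ¬ IsGradedIso (freeComponent r 3) (negativeComponent b S) φ := by
  intro hφ
  obtain ⟨x, hx, hx0⟩ := exists_ne_zero_mem_rootSpace_neg_root (β : H.root)
  obtain ⟨y, hy, hy0⟩ := exists_ne_zero_mem_rootSpace_neg_root (γ : H.root)
  have key {z : L} (hz : z ∈ component b S (-1)) :
      ∃ u ∈ freeComponent r 3 (-1), (φ u : L) = z := by
    have hz' : z ∈ negativePart b S :=
      Submodule.mem_iSup_of_mem (-1) (Submodule.mem_iSup_of_mem (by norm_num) hz)
    have : (⟨z, hz'⟩ : negativePart b S) ∈ negativeComponent b S (-1) := by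
      rw [negativeComponent, if_pos (by norm_num)]
      exact hz
    rw [← hφ (-1)] at this
    obtain ⟨u, hu, huz⟩ := this
    exact ⟨u, hu, congrArg Subtype.val huz⟩
  obtain ⟨u, hu, rfl⟩ := key (mem_component_of_mem_rootSpace_neg_root b hβ hx)
  obtain ⟨v, hv, rfl⟩ := key (mem_component_of_mem_rootSpace_neg_root b hγ hy)
  have hroot : -(IsKilling.rootSystem H).root β ≠ -(IsKilling.rootSystem H).root γ := by
    intro h
    exact hne (Subtype.ext ((IsKilling.rootSystem H).root.injective (neg_injective h)))
  have hlin : LinearIndependent ℂ ![u, v] := by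
    refine LinearIndependent.of_comp ((negativePart b S).toSubmodule.subtype ∘ₗ
      (φ.toLinearEquiv : FreeNilpotent r 3 →ₗ[ℂ] negativePart b S)) ?_
    convert linearIndependent_of_mem_rootSpace hroot hx hy hx0 hy0 using 1
    ext j
    fin_cases j <;> rfl
  refine lie_lie_ne_zero_of_mem_freeComponent_neg_one hu hv hlin (φ.injective (Subtype.ext ?_))
  have := lie_lie_eq_zero_of_neg_one_le_cartanMatrix b hne hc hx hy
  simpa using this

end Height

end GradedLie

theorem mainTheorem6 {L : Type*} [LieRing L] [LieAlgebra ℂ L] [FiniteDimensional ℂ L]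
    [LieAlgebra.IsSimple ℂ L] (H : LieSubalgebra ℂ L) [H.IsCartanSubalgebra]
    (b : (LieAlgebra.IsKilling.rootSystem H).Base)
    (n i : ℕ) (hi : 1 ≤ i) (hin : i < n)
    (e : Fin n ≃ b.support) (hC : GradedLie.IsTypeC b e)
    (S : Finset b.support)
    (hS : S = ({⟨i - 1, by omega⟩, ⟨n - 1, by omega⟩} : Finset (Fin n)).map e.toEmbedding)
    (r : ℕ) :
    ¬ ∃ φ : GradedLie.FreeNilpotent r 3 ≃ₗ⁅ℂ⁆ GradedLie.negativePart b S,
        GradedLie.IsGradedIso (GradedLie.freeComponent r 3)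
          (GradedLie.negativeComponent b S) φ := by
  rintro ⟨φ, hφ⟩
  have hne : (⟨i - 1, by omega⟩ : Fin n) ≠ ⟨n - 1, by omega⟩ := by
    rw [ne_eq, Fin.mk.injEq]
    omega
  refine GradedLie.not_isGradedIso_of_neg_one_le_cartanMatrix b
    (β := e ⟨i - 1, by omega⟩) (γ := e ⟨n - 1, by omega⟩) ?_ ?_ (e.injective.ne hne) ?_ φ hφ
  · simp [hS]
  · simp [hS]
  -- The entry at `(αᵢ, αₙ)` is `-1` or `0`: the entry `-2` occurs only in the row of `αₙ`.
  · rw [hC, CartanMatrix.C, Matrix.of_apply, if_neg hne]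
    split_ifs <;> first | omega | (simp only at *; omega)
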